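/- Let $d\ge 1$ and let $\psi\in L^1(\mathbb{R}^d)\cap C_b(\mathbb{R}^d)$ be a real-valued symmetric positive definite function, i.e. $\psi(-x)=\psi(x)$ and $\sum_{i,j}c_ic_j\psi(x_i-x_j)\ge 0$ for all finite families $x_i\in\mathbb{R}^d$, $c_i\in\mathbb{R}$. Let $k(x,y)=\psi(x-y)$, let $\mathcal{H}_k$ be the reproducing kernel Hilbert space of $k$, and for a Borel probability measure $P$ on $\mathbb{R}^d$ let $\mu_k(P)=\int k(\cdot,x)\,dP(x)\in\mathcal{H}_k$ (Bochner integral) be its kernel mean embedding. Assume that $k$ is characteristic, i.e. $P\mapsto\mu_k(P)$ is injective on Borel probability measures. Write $\psi^\wedge(w)=(2\pi)^{-d/2}\int_{\mathbb{R}^d}\psi(x)e^{-i\langle w,x\rangle}\,dx$, which is real-valued. Then there exist constants $c_\psi,\epsilon_\psi>0$, depending only on $\psi$, such that for every $a\in\mathbb{R}^d$ with $\|a\|_2^2\le\epsilon_\psi$, $$c_\psi\le\min_{\|e\|_2=1}2\int_{\mathbb{R}^d}e^{-\|w\|_2^2}\langle e,w\rangle^2\cos(\langle a,w\rangle)\,(\psi^\wedge(w))^2\,dw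 .\qquad(*)$$ Moreover, for all constants $c_\psi,\epsilon_\psi>0$ satisfying $(*)$ for every $a$ with $\|a\|_2^2\le\epsilon_\psi$, and for every integer $n\ge 1/\epsilon_\psi$, $$\inf_{\hat\theta_n}\ \sup_{P\in\mathcal{P}}\ P^n\left\{\|\hat\theta_n-\mu_k(P)\|_{L^2(\mathbb{R}^d)}\ge\frac12\sqrt{\frac{c_\psi}{2n}}\right\}\ge\frac14,$$ where $\mathcal{P}$ is the set of Borel probability measures on $\mathbb{R}^d$ that have a $C^\infty$ density with respect to Lebesgue measure, $P^n$ is the law of an i.i.d. sample $X_1,\dots,X_n$ from $P$, and the infimum is over all estimators $\hat\theta_n$, i.e. measurable maps from $(\mathbb{R}^d)^n$ to $L^2(\mathbb{R}^d)$. -/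

import Mathlib

open MeasureTheory
open scoped ENNReal RealInnerProductSpace ContDiff BoundedContinuousFunction

namespace KernelMean

/-- The space `ℝ^d` with its Euclidean norm, inner product and Lebesgue measure. -/
abbrev Eu (d : ℕ) : Type := EuclideanSpace ℝ (Fin d)

/-! ### Translation invariant kernels and their reproducing kernel Hilbert spaces -/

/-- `ψ` is a (symmetric) positive definite function: the matrix `(ψ (x - y))` indexed by all points
`x, y` of `ℝ^d` is symmetric, and `∑ i, ∑ j, c i * ψ (x i - x j) * c j ≥ 0` for all finite families
of points and real coefficients. -/
def IsPositiveDefinite {d : ℕ} (ψ : Eu d → ℝ) : Prop :=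
  (Matrix.of fun x y : Eu d => ψ (x - y)).PosSemidef

/-- The kernel `k (x, y) = ψ (x - y)`; a real number `r` is read as the operator `v ↦ r * v` on
`ℝ`. -/
noncomputable def transKernel {d : ℕ} (ψ : Eu d → ℝ) : Matrix (Eu d) (Eu d) (ℝ →L[ℝ] ℝ) :=
  Matrix.of fun x y => ψ (x - y) • ContinuousLinearMap.id ℝ ℝ

theorem IsPositiveDefinite.posSemidef_transKernel {d : ℕ} {ψ : Eu d → ℝ}
    (h : IsPositiveDefinite ψ) : (transKernel ψ).PosSemidef := by
  have hs : ∀ x y : Eu d, ψ (y - x) = ψ (x - y) := fun x y => by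
    simpa using h.1.apply x y
  have ht := (RKHS.posSemidef_tfae (K := transKernel ψ)).out 0 2
  refine ht.mpr ⟨?_, fun v => ?_⟩
  · ext x y
    have h1 : star (ContinuousLinearMap.id ℝ ℝ) = ContinuousLinearMap.id ℝ ℝ :=
      star_one (ℝ →L[ℝ] ℝ)
    simp [transKernel, hs x y, h1]
  · have h2 := h.2 v
    simp only [Finsupp.sum, RCLike.re_to_real] at h2 ⊢
    refine h2.trans_eq (Finset.sum_congr rfl fun x _ => Finset.sum_congr rfl fun y _ => ?_)
    simp [transKernel, hs x y]
    ring

/-- The reproducing kernel Hilbert space `H_k` of the kernel `k (x, y) = ψ (x - y)`. -/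
def Hk {d : ℕ} (ψ : Eu d → ℝ) (h : IsPositiveDefinite ψ) : Type :=
  haveI : Fact (transKernel ψ).PosSemidef := ⟨h.posSemidef_transKernel⟩
  RKHS.OfKernel (transKernel ψ)

noncomputable instance {d : ℕ} (ψ : Eu d → ℝ) (h : IsPositiveDefinite ψ) :
    NormedAddCommGroup (Hk ψ h) :=
  haveI : Fact (transKernel ψ).PosSemidef := ⟨h.posSemidef_transKernel⟩
  inferInstanceAs (NormedAddCommGroup (RKHS.OfKernel (transKernel ψ)))

noncomputable instance {d : ℕ} (ψ : Eu d → ℝ) (h : IsPositiveDefinite ψ) :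
    InnerProductSpace ℝ (Hk ψ h) :=
  haveI : Fact (transKernel ψ).PosSemidef := ⟨h.posSemidef_transKernel⟩
  inferInstanceAs (InnerProductSpace ℝ (RKHS.OfKernel (transKernel ψ)))

instance {d : ℕ} (ψ : Eu d → ℝ) (h : IsPositiveDefinite ψ) : CompleteSpace (Hk ψ h) :=
  haveI : Fact (transKernel ψ).PosSemidef := ⟨h.posSemidef_transKernel⟩
  inferInstanceAs (CompleteSpace (RKHS.OfKernel (transKernel ψ)))

/-- Elements of `H_k` are functions `ℝ^d → ℝ`. -/
noncomputable instance {d : ℕ} (ψ : Eu d → ℝ) (h : IsPositiveDefinite ψ) :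
    RKHS ℝ (Hk ψ h) (Eu d) ℝ :=
  haveI : Fact (transKernel ψ).PosSemidef := ⟨h.posSemidef_transKernel⟩
  inferInstanceAs (RKHS ℝ (RKHS.OfKernel (transKernel ψ)) (Eu d) ℝ)

theorem kernel_Hk {d : ℕ} (ψ : Eu d → ℝ) (h : IsPositiveDefinite ψ) :
    RKHS.kernel (Hk ψ h) = transKernel ψ :=
  haveI : Fact (transKernel ψ).PosSemidef := ⟨h.posSemidef_transKernel⟩
  RKHS.OfKernel.kernel_ofKernel (K := transKernel ψ)

/-- The function `k (·, x) = ψ (· - x)` as an element of `H_k`. -/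
noncomputable def feature {d : ℕ} (ψ : Eu d → ℝ) (h : IsPositiveDefinite ψ) (x : Eu d) : Hk ψ h :=
  RKHS.kerFun (Hk ψ h) x 1

theorem feature_apply {d : ℕ} (ψ : Eu d → ℝ) (h : IsPositiveDefinite ψ) (x y : Eu d) :
    feature ψ h x y = ψ (y - x) := by
  rw [feature, RKHS.kerFun_apply, kernel_Hk]
  simp [transKernel]

/-- The kernel mean embedding `μ_k (P) = ∫ k (·, x) dP(x)`, a Bochner integral in `H_k`. -/
noncomputable def kme {d : ℕ} (ψ : Eu d → ℝ) (h : IsPositiveDefinite ψ)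
    (P : ProbabilityMeasure (Eu d)) : Hk ψ h :=
  ∫ x, feature ψ h x ∂(P : Measure (Eu d))

/-- The kernel is characteristic: the kernel mean embedding is injective on Borel probability
measures. -/
def IsCharacteristic {d : ℕ} (ψ : Eu d → ℝ) (h : IsPositiveDefinite ψ) : Prop :=
  Function.Injective (kme ψ h)

/-! ### The condition on the constants -/

/-- The Fourier transform `ψ^(w) = (2π)^(-d/2) ∫ ψ(x) exp(-i⟨w, x⟩) dx`. -/
noncomputable def hat {d : ℕ} (ψ : Eu d → ℝ) (w : Eu d) : ℂ :=
  (((2 * Real.pi) ^ (-(d : ℝ) / 2) : ℝ) : ℂ) *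
    ∫ x, (ψ x : ℂ) * Complex.exp (-(Complex.I * (⟪w, x⟫ : ℝ)))

/-- The Fourier transform of a positive definite function is real, so its square is the square of
its absolute value. -/
theorem hat_sq {d : ℕ} {ψ : Eu d → ℝ} (h : IsPositiveDefinite ψ) (w : Eu d) :
    hat ψ w ^ 2 = ((‖hat ψ w‖ ^ 2 : ℝ) : ℂ) := by
  have hs : ∀ x : Eu d, ψ (-x) = ψ x := fun x => by
    simpa using h.1.apply x 0
  have hc : (starRingEnd ℂ) (hat ψ w) = hat ψ w := by
    unfold hat
    rw [map_mul, Complex.conj_ofReal, ← integral_conj, ← integral_neg_eq_self]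
    congr 2
    funext x
    rw [map_mul, Complex.conj_ofReal, ← Complex.exp_conj, hs]
    simp [inner_neg_right]
  rw [sq, Complex.ofReal_pow, ← Complex.conj_mul', hc]

/-- The positive numbers `c` and `ε` satisfy, for all `a` with `‖a‖² ≤ ε`,
`c ≤ min_{‖e‖ = 1} 2 ∫ exp(-σ²‖w‖²) ⟨e, w⟩² cos⟨a, w⟩ (ψ^(w))² dw`. Here `v` stands for `σ²`. -/
def AdmissibleConstants {d : ℕ} (ψ : Eu d → ℝ) (v c ε : ℝ) : Prop :=
  0 < c ∧ 0 < ε ∧ ∀ a : Eu d, ‖a‖ ^ 2 ≤ ε → ∀ e : Eu d, ‖e‖ = 1 →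
    c ≤ 2 * ∫ w : Eu d,
      Real.exp (-(v * ‖w‖ ^ 2)) * ⟪e, w⟫ ^ 2 * Real.cos ⟪a, w⟫ * ‖hat ψ w‖ ^ 2

/-! ### The minimax probability -/

/-- The Borel probability measures on `ℝ^d` that have an infinitely differentiable density with
respect to the Lebesgue measure. -/
def smoothDensity (d : ℕ) : Set (ProbabilityMeasure (Eu d)) :=
  {P | ∃ p : Eu d → ℝ, ContDiff ℝ ∞ p ∧ (∀ x, 0 ≤ p x) ∧
    (P : Measure (Eu d)) = (volume : Measure (Eu d)).withDensity fun x => ENNReal.ofReal (p x)}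

/-- Estimators: (Borel) measurable maps from samples of size `n` to `L²(ℝ^d)`. As `L²(ℝ^d)` is
separable, Borel measurability is the same as strong measurability. -/
def Estimator (d n : ℕ) : Type :=
  {θ : (Fin n → Eu d) → Lp ℝ 2 (volume : Measure (Eu d)) // StronglyMeasurable θ}

/-- The minimax probability `inf_θ sup_{P ∈ S} P^n {‖θ - μ_k(P)‖_{L²(ℝ^d)} ≥ s}`. -/
noncomputable def minimaxProb {d : ℕ} (ψ : Eu d → ℝ) (h : IsPositiveDefinite ψ)
    (S : Set (ProbabilityMeasure (Eu d))) (n : ℕ) (s : ℝ) : ℝ≥0∞ :=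
  ⨅ θ : Estimator d n, ⨆ P ∈ S,
    Measure.pi (fun _ : Fin n => (P : Measure (Eu d)))
      {x | ENNReal.ofReal s ≤ eLpNorm (fun y => θ.1 x y - kme ψ h P y) 2 volume}

end KernelMean

namespace KernelMean

/-! ### Gaussian location family -/

/-! The lower bound is Le Cam's two-point method for the Gaussians `gauss a` and `gauss (-a)` with
`2a = t e`, `‖e‖ = 1`, `t = 1/√n`.

Since `n‖a‖² = 1/4`, the samples stay hard to distinguish: the geometric mean of their two densities
is `exp(-1/8)` times the centered density, and a weighted AM-GM inequality keeps the sum of the two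
testing errors at least `1/2` (`half_le_pi_gauss_add`). One of the two errors is then at least
`1/4`.

The embeddings nevertheless lie at least `√(c/(2n))` apart in `L²`. By Plancherel their squared
distance is a Gaussian-weighted integral of `1 - cos(t⟨e, w⟩)` against `|ψ^|²`
(`integral_sq_kme_gauss_sub`). Writing `1 - cos` by Taylor's formula with integral remainder turns
it into an average over `s ∈ [0, t]` of the integrals bounded below by the admissibility condition
at the points `s e` (`AdmissibleConstants.sq_le_integral`); these points are allowed because `t² =
1/n ≤ ε`.

Admissible constants exist because a characteristic kernel has `ψ ≠ 0`, hence `ψ^ ≠ 0`. The integral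
is then positive at `a = 0` for every `e`, and compactness of the sphere makes this uniform near `a
= 0`. -/

/-- The density of the Gaussian measure on `ℝ^d` with mean `a` and identity covariance. -/
noncomputable def gaussDensity {d : ℕ} (a x : Eu d) : ℝ :=
  (2 * Real.pi) ^ (-(d : ℝ) / 2) * Real.exp (-(1 / 2) * ‖x - a‖ ^ 2)

theorem gaussDensity_pos {d : ℕ} (a x : Eu d) : 0 < gaussDensity a x := by
  unfold gaussDensity
  positivity

theorem contDiff_gaussDensity {d : ℕ} (a : Eu d) : ContDiff ℝ ∞ (gaussDensity a) := by
  unfold gaussDensity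
  exact contDiff_const.mul
    (Real.contDiff_exp.comp (contDiff_const.mul ((contDiff_id.sub contDiff_const).norm_sq ℝ)))

theorem integral_gaussDensity {d : ℕ} (a : Eu d) : ∫ x, gaussDensity a x = 1 := by
  unfold gaussDensity
  rw [integral_const_mul,
    integral_sub_right_eq_self (fun x : Eu d => Real.exp (-(1 / 2) * ‖x‖ ^ 2)) a,
    GaussianFourier.integral_rexp_neg_mul_sq_norm (by norm_num), finrank_euclideanSpace_fin,
    div_div_eq_mul_div, div_one, mul_comm Real.pi, ← Real.rpow_add (by positivity)]
  simp [neg_div]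

theorem integrable_gaussDensity {d : ℕ} (a : Eu d) : Integrable (gaussDensity a) := by
  by_contra h
  simpa [integral_undef h] using integral_gaussDensity a

/-- The Gaussian measure on `ℝ^d` with mean `a` and identity covariance. -/
noncomputable def gauss {d : ℕ} (a : Eu d) : ProbabilityMeasure (Eu d) :=
  ⟨volume.withDensity fun x => ENNReal.ofReal (gaussDensity a x), by
    rw [isProbabilityMeasure_iff, withDensity_apply _ MeasurableSet.univ, Measure.restrict_univ,
      ← ofReal_integral_eq_lintegral_ofReal (integrable_gaussDensity a)
        (.of_forall fun x => (gaussDensity_pos a x).le), integral_gaussDensity, ENNReal.ofReal_one]⟩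

theorem gauss_toMeasure {d : ℕ} (a : Eu d) : (gauss a : Measure (Eu d)) =
    volume.withDensity fun x => ENNReal.ofReal (gaussDensity a x) := rfl

theorem gauss_mem_smoothDensity {d : ℕ} (a : Eu d) : gauss a ∈ smoothDensity d :=
  ⟨gaussDensity a, contDiff_gaussDensity a, fun x => (gaussDensity_pos a x).le, rfl⟩

/-- By the parallelogram law the cross terms in the exponents cancel. -/
theorem gaussDensity_mul_gaussDensity_neg {d : ℕ} (a x : Eu d) :
    gaussDensity a x * gaussDensity (-a) x = Real.exp (-‖a‖ ^ 2) * gaussDensity 0 x ^ 2 := by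
  unfold gaussDensity
  have h : ‖x - a‖ ^ 2 + ‖x - -a‖ ^ 2 = 2 * ‖x‖ ^ 2 + 2 * ‖a‖ ^ 2 := by
    have := parallelogram_law_with_norm ℝ x a
    rw [sub_neg_eq_add]
    nlinarith
  generalize (2 * Real.pi) ^ (-(d : ℝ) / 2) = C
  rw [mul_mul_mul_comm, ← Real.exp_add, ← mul_add, h, mul_pow, ← Real.exp_nat_mul, mul_left_comm,
    ← Real.exp_add, ← sq, sub_zero]
  congr 2
  push_cast
  ring

/-- A finite power of a measure with a density has the product of the densities as density. -/
theorem pi_withDensity_ofReal {X : Type*} [MeasurableSpace X] {μ : Measure X} [SigmaFinite μ]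
    {f : X → ℝ} (hf : Integrable f μ) (h0 : ∀ x, 0 ≤ f x) (n : ℕ) :
    Measure.pi (fun _ : Fin n => μ.withDensity fun x => ENNReal.ofReal (f x)) =
      (Measure.pi fun _ : Fin n => μ).withDensity fun x => ENNReal.ofReal (∏ i, f (x i)) := by
  have : SigmaFinite (μ.withDensity fun x => ENNReal.ofReal (f x)) :=
    SigmaFinite.withDensity_ofReal f
  refine Measure.pi_eq fun s hs => ?_
  -- On a box the indicator factors over the coordinates, so Fubini applies to a product of
  -- one-variable functions.
  have key : ∀ x : Fin n → X, (Set.univ.pi s).indicator (fun x => ENNReal.ofReal (∏ i, f (x i))) x =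
      ENNReal.ofReal (∏ i, (s i).indicator f (x i)) := by
    intro x
    by_cases hx : x ∈ Set.univ.pi s
    · rw [Set.indicator_of_mem hx]
      congr 1
      exact Finset.prod_congr rfl fun i _ => (Set.indicator_of_mem (hx i trivial) f).symm
    · rw [Set.indicator_of_notMem hx]
      simp only [Set.mem_pi, Set.mem_univ, forall_const, not_forall] at hx
      obtain ⟨i, hi⟩ := hx
      rw [Finset.prod_eq_zero (Finset.mem_univ i) (Set.indicator_of_notMem hi f),
        ENNReal.ofReal_zero]
  have hn : ∀ i x, 0 ≤ (s i).indicator f x := fun i => Set.indicator_nonneg fun x _ => h0 x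
  have hI : ∀ i, Integrable ((s i).indicator f) μ := fun i => hf.indicator (hs i)
  rw [withDensity_apply _ (MeasurableSet.univ_pi hs),
    ← lintegral_indicator (MeasurableSet.univ_pi hs), lintegral_congr key,
    ← ofReal_integral_eq_lintegral_ofReal (Integrable.fintype_prod (fun i => hI i))
      (.of_forall fun x => Finset.prod_nonneg fun i _ => hn i _),
    integral_fintype_prod_eq_prod, ENNReal.ofReal_prod_of_nonneg
      fun i _ => integral_nonneg (hn i)]
  refine Finset.prod_congr rfl fun i _ => ?_
  rw [withDensity_apply _ (hs i),
    ofReal_integral_eq_lintegral_ofReal (hI i) (.of_forall (hn i)), ← lintegral_indicator (hs i)]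
  refine lintegral_congr fun x => ?_
  by_cases hx : x ∈ s i <;> simp [hx]

/-- Two symmetric Gaussian samples with small separation dominate a centered Gaussian sample. -/
theorem pi_gauss_zero_le {d n : ℕ} (a : Eu d) (ha : n * ‖a‖ ^ 2 = 1 / 4) (B : Set (Fin n → Eu d)) :
    ENNReal.ofReal (7 / 4) * Measure.pi (fun _ : Fin n => (gauss (0 : Eu d) : Measure (Eu d))) B ≤
      ENNReal.ofReal 2 * Measure.pi (fun _ : Fin n => (gauss a : Measure (Eu d))) B +
      ENNReal.ofReal (1 / 2) * Measure.pi (fun _ : Fin n => (gauss (-a) : Measure (Eu d))) B := by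
  have hm : ∀ b : Eu d, Measurable fun x : Fin n → Eu d => ∏ i, gaussDensity b (x i) := fun b =>
    Finset.measurable_prod _ fun i _ =>
      (contDiff_gaussDensity b).continuous.measurable.comp (measurable_pi_apply i)
  simp only [gauss_toMeasure, pi_withDensity_ofReal (integrable_gaussDensity _)
    fun x => (gaussDensity_pos _ x).le]
  rw [← smul_eq_mul, ← smul_eq_mul, ← smul_eq_mul, ← Measure.smul_apply, ← Measure.smul_apply,
    ← Measure.smul_apply, ← Measure.add_apply, ← withDensity_smul _ (hm 0).ennreal_ofReal,
    ← withDensity_smul _ (hm a).ennreal_ofReal, ← withDensity_smul _ (hm (-a)).ennreal_ofReal,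
    ← withDensity_add_left ((hm a).ennreal_ofReal.const_smul _)]
  refine withDensity_mono (.of_forall fun x => ?_) B
  have hp : ∀ b : Eu d, 0 < ∏ i, gaussDensity b (x i) := fun b =>
    Finset.prod_pos fun i _ => gaussDensity_pos b _
  simp only [Pi.smul_apply, Pi.add_apply, smul_eq_mul]
  rw [← ENNReal.ofReal_mul (by norm_num), ← ENNReal.ofReal_mul (by norm_num),
    ← ENNReal.ofReal_mul (by norm_num),
    ← ENNReal.ofReal_add (by have := hp a; positivity) (by have := hp (-a); positivity)]
  have hxy : (∏ i, gaussDensity a (x i)) * ∏ i, gaussDensity (-a) (x i) =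
      Real.exp (-(1 / 8)) ^ 2 * (∏ i, gaussDensity 0 (x i)) ^ 2 := by
    rw [← Finset.prod_mul_distrib]
    simp only [gaussDensity_mul_gaussDensity_neg]
    rw [Finset.prod_mul_distrib, Finset.prod_pow, Finset.prod_const, Finset.card_univ,
      Fintype.card_fin, ← Real.exp_nat_mul, ← Real.exp_nat_mul, mul_neg, ha]
    norm_num
  have he : 7 / 8 ≤ Real.exp (-(1 / 8)) := by
    have := Real.add_one_le_exp (-(1 / 8) : ℝ)
    linarith
  refine ENNReal.ofReal_le_ofReal ?_
  have h0 := hp 0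
  have h1 := hp a
  have h2 := hp (-a)
  refine (pow_le_pow_iff_left₀ (by positivity) (by positivity) two_ne_zero).mp ?_
  have he2 := mul_le_mul_of_nonneg_right (pow_le_pow_left₀ (by norm_num) he 2)
    (sq_nonneg (∏ i, gaussDensity 0 (x i)))
  rw [← hxy] at he2
  -- AM-GM as a completed square: `(2p + q/2)² ≥ 4pq ≥ 4 (7/8)² p₀² = (7/4 p₀)²`.
  linarith [sq_nonneg (2 * (∏ i, gaussDensity a (x i)) - 1 / 2 * ∏ i, gaussDensity (-a) (x i))]

/-- **Le Cam's two-point bound** for two symmetric Gaussian samples. -/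
theorem half_le_pi_gauss_add {d n : ℕ} (a : Eu d) (ha : n * ‖a‖ ^ 2 = 1 / 4)
    {A B : Set (Fin n → Eu d)} (hAB : Aᶜ ⊆ B) :
    1 / 2 ≤ Measure.pi (fun _ : Fin n => (gauss a : Measure (Eu d))) A +
      Measure.pi (fun _ : Fin n => (gauss (-a) : Measure (Eu d))) B := by
  set P := fun b : Eu d => Measure.pi (fun _ : Fin n => (gauss b : Measure (Eu d)))
  have hP : ∀ b, IsProbabilityMeasure (P b) := fun b => by infer_instance
  -- `A` need not be measurable; its hull has the same `P a`-measure, and the complement of the hull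
  -- still lies in `B`.
  set T := toMeasurable (P a) A
  have hT : MeasurableSet T := measurableSet_toMeasurable _ _
  have hT' : P a T = P a A := measure_toMeasurable A
  have hB : P (-a) Tᶜ ≤ P (-a) B :=
    measure_mono ((Set.compl_subset_compl.mpr (subset_toMeasurable _ _)).trans hAB)
  -- The weights 2 and 1/2 are swapped between `T` and its complement. Adding the two bounds gives
  -- `7/4 ≤ 1 + 3/2 (P a T + P (-a) Tᶜ)`.
  have h1 : _ * P 0 T ≤ _ * P a T + _ * P (-a) T := pi_gauss_zero_le a ha T
  have h2 : _ * P 0 Tᶜ ≤ _ * P (-a) Tᶜ + _ * P (- -a) Tᶜ :=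
    pi_gauss_zero_le (-a) (by rwa [norm_neg]) Tᶜ
  rw [neg_neg] at h2
  change _ ≤ P a A + P (-a) B
  rw [← hT']
  refine le_trans ?_ (add_le_add_right hB _)
  clear_value T P
  have h0 : ∀ b s, P b s = ENNReal.ofReal ((P b).real s) := fun b s => by rw [ofReal_measureReal]
  simp only [h0, probReal_compl_eq_one_sub hT] at h1 h2 ⊢
  have h3 : ∀ b, 0 ≤ (P b).real T := fun b => measureReal_nonneg
  have h4 : ∀ b, (P b).real T ≤ 1 := fun b => measureReal_le_one
  rw [← ENNReal.ofReal_mul (by norm_num), ← ENNReal.ofReal_mul (by norm_num),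
    ← ENNReal.ofReal_mul (by norm_num), ← ENNReal.ofReal_add (by have := h3 a; positivity)
    (by have := h3 (-a); positivity), ENNReal.ofReal_le_ofReal_iff (by
      have := h3 a; have := h3 (-a); positivity)] at h1
  have h5 : ∀ b, 0 ≤ 1 - (P b).real T := fun b => sub_nonneg.mpr (h4 b)
  rw [← ENNReal.ofReal_mul (by norm_num), ← ENNReal.ofReal_mul (by norm_num),
    ← ENNReal.ofReal_mul (by norm_num), ← ENNReal.ofReal_add
    (mul_nonneg (by norm_num) (h5 _)) (mul_nonneg (by norm_num) (h5 _)),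
    ENNReal.ofReal_le_ofReal_iff (add_nonneg
    (mul_nonneg (by norm_num) (h5 _)) (mul_nonneg (by norm_num) (h5 _)))] at h2
  have h6 : (1 / 2 : ℝ≥0∞) = ENNReal.ofReal (1 / 2) := by
    rw [ENNReal.ofReal_div_of_pos (by norm_num)]
    simp
  rw [← ENNReal.ofReal_add (h3 a) (h5 _), h6]
  exact ENNReal.ofReal_le_ofReal (by linarith)

/-! ### Kernel mean embeddings as functions -/

theorem inner_feature {d : ℕ} (ψ : Eu d → ℝ) (h : IsPositiveDefinite ψ) (x : Eu d) (f : Hk ψ h) :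
    ⟪feature ψ h x, f⟫ = f x := by
  rw [feature, RKHS.kerFun_inner]
  simp

/-- The reproducing property gives `‖k(·,x) - k(·,x₀)‖² = 2ψ(0) - 2ψ(x - x₀)`. -/
theorem continuous_feature {d : ℕ} {ψ : Eu d → ℝ} (hψ : Continuous ψ)
    (h : IsPositiveDefinite ψ) : Continuous (feature ψ h) := by
  refine continuous_iff_continuousAt.mpr fun x₀ => tendsto_iff_norm_sub_tendsto_zero.mpr ?_
  have hs : ∀ x, ψ (x - x₀) = ψ (x₀ - x) := fun x => by simpa using h.1.apply x₀ x
  have he : ∀ x, ‖feature ψ h x - feature ψ h x₀‖ = √(2 * ψ 0 - 2 * ψ (x - x₀)) := by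
    intro x
    rw [norm_eq_sqrt_real_inner, inner_sub_left, inner_sub_right, inner_sub_right]
    simp only [inner_feature, feature_apply, sub_self, hs]
    congr 1
    ring
  simp only [he]
  have hc : Continuous fun x => √(2 * ψ 0 - 2 * ψ (x - x₀)) := by fun_prop
  simpa using hc.tendsto x₀

theorem integrable_feature {d : ℕ} {ψ : Eu d → ℝ} (hψ : Continuous ψ)
    (h : IsPositiveDefinite ψ) (P : ProbabilityMeasure (Eu d)) :
    Integrable (feature ψ h) (P : Measure (Eu d)) := by
  refine Integrable.of_bound (continuous_feature hψ h).aestronglyMeasurable (√(ψ 0))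
    (.of_forall fun x => ?_)
  rw [norm_eq_sqrt_real_inner, inner_feature, feature_apply, sub_self]

theorem kme_apply {d : ℕ} {ψ : Eu d → ℝ} (hψ : Continuous ψ) (h : IsPositiveDefinite ψ)
    (P : ProbabilityMeasure (Eu d)) (y : Eu d) :
    kme ψ h P y = ∫ x, ψ (y - x) ∂(P : Measure (Eu d)) := by
  rw [← inner_feature, kme, ← integral_inner (integrable_feature hψ h P)]
  simp only [inner_feature, feature_apply]

theorem continuous_coe_Hk {d : ℕ} {ψ : Eu d → ℝ} (hψ : Continuous ψ) (h : IsPositiveDefinite ψ)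
    (f : Hk ψ h) : Continuous fun y => f y := by
  simp only [← inner_feature]
  exact (continuous_feature hψ h).inner continuous_const

theorem kme_gauss_apply {d : ℕ} {ψ : Eu d → ℝ} (hψ : Continuous ψ) (h : IsPositiveDefinite ψ)
    (a y : Eu d) : kme ψ h (gauss a) y = ∫ x, gaussDensity a x * ψ (y - x) := by
  rw [kme_apply hψ, gauss_toMeasure, integral_withDensity_eq_integral_toReal_smul
    (contDiff_gaussDensity a).continuous.measurable.ennreal_ofReal
    (.of_forall fun x => ENNReal.ofReal_lt_top)]
  simp only [ENNReal.toReal_ofReal (gaussDensity_pos a _).le, smul_eq_mul]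

/-- If `ψ = 0`, all embeddings vanish, yet the Dirac masses at two distinct points differ; `d ≥ 1`
supplies the second point. -/
theorem exists_ne_zero_of_isCharacteristic {d : ℕ} (hd : 1 ≤ d) {ψ : Eu d → ℝ}
    {h : IsPositiveDefinite ψ} (hchar : IsCharacteristic ψ h) : ∃ x, ψ x ≠ 0 := by
  by_contra! h0
  have hf : ∀ x, feature ψ h x = 0 := fun x => by
    ext y
    simp [feature_apply, h0]
  have hk : ∀ P, kme ψ h P = 0 := fun P => by simp [kme, hf]
  let e : Eu d := EuclideanSpace.single ⟨0, hd⟩ 1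
  let D : Eu d → ProbabilityMeasure (Eu d) := fun x => ⟨Measure.dirac x, inferInstance⟩
  have hD : D 0 = D e := hchar ((hk _).trans (hk _).symm)
  have h1 := congrArg (fun P : ProbabilityMeasure (Eu d) => (P : Measure (Eu d)) {0}) hD
  have he : e ≠ 0 := by simp [e]
  simp [D, he] at h1

section Fourier

/-! ### Fourier analysis -/

open scoped FourierTransform Convolution

/-- **Plancherel's theorem** for a continuous integrable function with an integrable Fourier
transform. -/
theorem integral_norm_sq_fourier {d : ℕ} {g : Eu d → ℂ} (hc : Continuous g) (hg : Integrable g)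
    (hg' : Integrable (𝓕 g)) : ∫ w, ‖𝓕 g w‖ ^ 2 = ∫ x, ‖g x‖ ^ 2 := by
  -- The transform is moved across the inner product of `𝓕 g` with itself; Fourier inversion then
  -- recovers `g`.
  have h := VectorFourier.integral_sesq_fourierIntegral_eq_neg_flip (μ := volume) (ν := volume)
    (L := innerₗ (Eu d)) (innerSL ℂ (E := ℂ)) Real.continuous_fourierChar continuous_inner hg hg'
  have hinv := hc.fourierInv_fourier_eq hg hg'
  rw [flip_innerₗ] at h
  change ∫ ξ, inner ℂ (𝓕 g ξ) (𝓕 g ξ) = ∫ x, inner ℂ (g x) (𝓕⁻ (𝓕 g) x) at h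
  simp only [hinv, inner_self_eq_norm_sq_to_K] at h
  have h2 : ((∫ w, ‖𝓕 g w‖ ^ 2 : ℝ) : ℂ) = ((∫ x, ‖g x‖ ^ 2 : ℝ) : ℂ) := by
    rw [← integral_complex_ofReal, ← integral_complex_ofReal]
    simpa using h
  exact_mod_cast h2

theorem fourier_gaussDensity {d : ℕ} (a w : Eu d) :
    𝓕 (fun x => (gaussDensity a x : ℂ)) w =
      Complex.exp (-(2 * Real.pi ^ 2 * ‖w‖ ^ 2 : ℝ)) *
        Complex.exp (-((2 * Real.pi * ⟪a, w⟫ : ℝ) * Complex.I)) := by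
  set f : Eu d → ℂ := fun x => Complex.exp (-(1 / 2 : ℂ) * ‖x‖ ^ 2) with hf
  have h1 : (fun x => (gaussDensity a x : ℂ)) =
      (((2 * Real.pi) ^ (-(d : ℝ) / 2) : ℝ) : ℂ) • (f ∘ fun x => x + -a) := by
    funext x
    simp [gaussDensity, hf, ← sub_eq_add_neg]
  have h2 := congrFun (VectorFourier.fourierIntegral_comp_add_right Real.fourierChar volume
    (innerₗ (Eu d)) f (-a)) w
  have h3 := fourier_gaussian_innerProductSpace (V := Eu d) (b := 1 / 2) (by norm_num) w
  have h4 := VectorFourier.fourierIntegral_const_smul Real.fourierChar volume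
    (innerₗ (Eu d)) (f ∘ fun x => x + -a) (((2 * Real.pi) ^ (-(d : ℝ) / 2) : ℝ) : ℂ)
  have h5 : (Real.pi / (1 / 2) : ℂ) ^ (Module.finrank ℝ (Eu d) / 2 : ℂ) =
      (((2 * Real.pi) ^ ((d : ℝ) / 2) : ℝ) : ℂ) := by
    rw [Complex.ofReal_cpow (by positivity), finrank_euclideanSpace_fin]
    push_cast
    congr 1
    ring
  have h6 : (2 * Real.pi) ^ (-(d : ℝ) / 2) * (2 * Real.pi) ^ ((d : ℝ) / 2) = 1 := by
    rw [← Real.rpow_add (by positivity)]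
    simp [neg_div]
  rw [h1]
  refine (congrFun h4 w).trans ?_
  rw [Pi.smul_apply, h2]
  change _ • _ • 𝓕 f w = _
  rw [h3, h5, Circle.smul_def, Real.fourierChar_apply, smul_eq_mul, smul_eq_mul, mul_left_comm,
    ← mul_assoc (Complex.ofReal _), ← Complex.ofReal_mul, h6, Complex.ofReal_one, one_mul, mul_comm]
  congr 2
  · push_cast
    ring
  · simp only [innerₗ_apply_apply, inner_neg_left]
    push_cast
    ring

/-- Dictionary between the angular-frequency convention of `hat` and the kernel `exp(-2πi⟨x, w⟩)` of
`𝓕`. -/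
theorem hat_eq_fourier {d : ℕ} (ψ : Eu d → ℝ) (w : Eu d) :
    hat ψ w = (((2 * Real.pi) ^ (-(d : ℝ) / 2) : ℝ) : ℂ) *
      𝓕 (fun x => (ψ x : ℂ)) ((2 * Real.pi)⁻¹ • w) := by
  rw [hat, Real.fourier_eq']
  congr 2
  funext x
  rw [smul_eq_mul, mul_comm, inner_smul_right, real_inner_comm]
  congr 2
  have : Real.pi ≠ 0 := Real.pi_ne_zero
  push_cast
  field_simp

theorem continuous_hat {d : ℕ} {ψ : Eu d → ℝ} (hint : Integrable ψ) : Continuous (hat ψ) := by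
  have : Continuous (𝓕 fun x => (ψ x : ℂ)) :=
    VectorFourier.fourierIntegral_continuous Real.continuous_fourierChar continuous_inner
      hint.ofReal
  simp only [funext (hat_eq_fourier ψ)]
  fun_prop

theorem exists_norm_hat_le {d : ℕ} (ψ : Eu d → ℝ) : ∃ C, ∀ w, ‖hat ψ w‖ ≤ C := by
  refine ⟨‖(((2 * Real.pi) ^ (-(d : ℝ) / 2) : ℝ) : ℂ)‖ * ∫ x, ‖(ψ x : ℂ)‖, fun w => ?_⟩
  rw [hat_eq_fourier, norm_mul]
  exact mul_le_mul_of_nonneg_left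
    (VectorFourier.norm_fourierIntegral_le_integral_norm _ _ _ _ _) (norm_nonneg _)

theorem exists_hat_ne_zero {d : ℕ} {ψ : Eu d → ℝ} (hc : Continuous ψ) (hint : Integrable ψ)
    (h : ∃ x, ψ x ≠ 0) : ∃ w, hat ψ w ≠ 0 := by
  by_contra! h0
  obtain ⟨x, hx⟩ := h
  have hF : 𝓕 (fun x => (ψ x : ℂ)) = 0 := by
    funext w
    have h1 := h0 ((2 * Real.pi) • w)
    rw [hat_eq_fourier, smul_smul, inv_mul_cancel₀ (by positivity), one_smul] at h1
    refine (mul_eq_zero.mp h1).resolve_left ?_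
    exact_mod_cast (by positivity : (2 * Real.pi) ^ (-(d : ℝ) / 2) ≠ 0)
  have hinv := Continuous.fourierInv_fourier_eq (f := fun x => (ψ x : ℂ))
    (Complex.continuous_ofReal.comp hc) hint.ofReal (by rw [hF]; exact integrable_zero _ _ _)
  have h2 := congrFun hinv x
  rw [hF, Real.fourierInv_eq] at h2
  simp at h2
  exact hx (by exact_mod_cast h2.symm)

/-- The two phases are conjugate, so they differ by `-2i sin t`, and `4 sin² t = 2(1 - cos 2t)`. -/
theorem sq_norm_fourier_gaussDensity_sub {d : ℕ} (a w : Eu d) :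
    ‖𝓕 (fun x => (gaussDensity a x : ℂ)) w - 𝓕 (fun x => (gaussDensity (-a) x : ℂ)) w‖ ^ 2 =
      2 * (Real.exp (-(4 * Real.pi ^ 2 * ‖w‖ ^ 2)) * (1 - Real.cos (4 * Real.pi * ⟪a, w⟫))) := by
  set t : ℝ := 2 * Real.pi * ⟪a, w⟫ with ht
  have h1 : Complex.exp (-((t : ℝ) * Complex.I)) -
      Complex.exp (-((2 * Real.pi * ⟪-a, w⟫ : ℝ) * Complex.I)) =
      ((-2 * Real.sin t : ℝ) : ℂ) * Complex.I := by
    rw [inner_neg_left, mul_neg, ← ht, Complex.ofReal_neg, neg_mul, neg_neg, ← neg_mul,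
      ← Complex.ofReal_neg, Complex.exp_mul_I, Complex.exp_mul_I]
    push_cast
    rw [Complex.cos_neg, Complex.sin_neg]
    ring
  rw [fourier_gaussDensity, fourier_gaussDensity, ← mul_sub, h1, norm_mul, norm_mul,
    Complex.norm_I, mul_one, Complex.norm_real, mul_pow, Real.norm_eq_abs, sq_abs,
    ← Complex.ofReal_neg, ← Complex.ofReal_exp, Complex.norm_real, Real.norm_eq_abs, sq_abs,
    ← Real.exp_nat_mul, show 4 * Real.pi * ⟪a, w⟫ = 2 * t by rw [ht]; ring, Real.cos_two_mul,
    Real.cos_sq', show ((2 : ℕ) : ℝ) * -(2 * Real.pi ^ 2 * ‖w‖ ^ 2) =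
      -(4 * Real.pi ^ 2 * ‖w‖ ^ 2) by push_cast; ring]
  ring

/-- The squared `L²` distance between the embeddings of two symmetric Gaussian measures. -/
theorem integral_sq_kme_gauss_sub {d : ℕ} {ψ : Eu d → ℝ} (hc : Continuous ψ)
    (hint : Integrable ψ) (h : IsPositiveDefinite ψ) (a : Eu d) :
    ∫ y, (kme ψ h (gauss a) y - kme ψ h (gauss (-a)) y) ^ 2 =
      2 * ∫ w : Eu d, Real.exp (-‖w‖ ^ 2) * (1 - Real.cos (2 * ⟪a, w⟫)) * ‖hat ψ w‖ ^ 2 := by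
  set p : Eu d → Eu d → ℂ := fun b x => (gaussDensity b x : ℂ) with hp
  set u : Eu d → ℂ := fun x => (ψ x : ℂ) with hu
  set g : Eu d → ℂ := fun y => ((kme ψ h (gauss a) y - kme ψ h (gauss (-a)) y : ℝ) : ℂ) with hg
  have hpi : ∀ b, Integrable (p b) := fun b => (integrable_gaussDensity b).ofReal
  have hui : Integrable u := hint.ofReal
  have hgc : Continuous g := Complex.continuous_ofReal.comp
    ((continuous_coe_Hk hc h _).sub (continuous_coe_Hk hc h _))
  have hconv : ∀ b, (fun y => (kme ψ h (gauss b) y : ℂ)) =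
      p b ⋆[ContinuousLinearMap.mul ℂ ℂ] u := by
    intro b
    funext y
    rw [kme_gauss_apply hc, ← integral_complex_ofReal]
    simp [convolution, hp, hu]
  have hci : ∀ b, Integrable (fun y => (kme ψ h (gauss b) y : ℂ)) := fun b => by
    rw [hconv]
    exact (hpi b).integrable_convolution _ hui
  have hgsub : g = fun y => (kme ψ h (gauss a) y : ℂ) - (kme ψ h (gauss (-a)) y : ℂ) := by
    funext y
    simp [hg]
  have hgi : Integrable g := by
    rw [hgsub]
    exact (hci a).sub (hci (-a))
  have hF : ∀ w, 𝓕 g w = (𝓕 (p a) w - 𝓕 (p (-a)) w) * 𝓕 u w := by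
    intro w
    rw [sub_mul, ← Real.fourier_mul_convolution_eq (hpi a) hui,
      ← Real.fourier_mul_convolution_eq (hpi (-a)) hui, ← hconv, ← hconv, hgsub,
      Real.fourier_eq, Real.fourier_eq, Real.fourier_eq, ← integral_sub
        ((Real.fourierIntegral_convergent_iff w).mpr (hci a))
        ((Real.fourierIntegral_convergent_iff w).mpr (hci (-a)))]
    simp only [smul_sub]
  have hFp : ∀ b, Integrable (𝓕 (p b)) := by
    intro b
    refine (GaussianFourier.integrable_cexp_neg_mul_sq_norm_add (V := Eu d)
      (b := ((2 * Real.pi ^ 2 : ℝ) : ℂ)) (by rw [Complex.ofReal_re]; positivity)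
      (-(2 * Real.pi * Complex.I)) b).congr (.of_forall fun w => ?_)
    simp only [hp, fourier_gaussDensity]
    rw [← Complex.exp_add]
    congr 1
    push_cast
    ring
  -- Gaussian decay supplies the integrability; `𝓕 u` only needs to be bounded.
  have hFi : Integrable (𝓕 g) := by
    rw [funext hF]
    exact ((hFp a).sub (hFp (-a))).mul_bdd (c := ∫ x, ‖u x‖)
      (VectorFourier.fourierIntegral_continuous Real.continuous_fourierChar continuous_inner
        hui).aestronglyMeasurable
      (.of_forall fun w => VectorFourier.norm_fourierIntegral_le_integral_norm _ _ _ _ w)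
  have hPl := integral_norm_sq_fourier hgc hgi hFi
  have hl : ∀ y, ‖g y‖ ^ 2 = (kme ψ h (gauss a) y - kme ψ h (gauss (-a)) y) ^ 2 := fun y => by
    rw [hg, Complex.norm_real, Real.norm_eq_abs, sq_abs]
  simp only [hl] at hPl
  rw [← hPl, ← integral_const_mul]
  have hpi2 : (0 : ℝ) < 2 * Real.pi := by positivity
  have hsub := Measure.integral_comp_smul (volume : Measure (Eu d)) (fun w => ‖𝓕 g w‖ ^ 2)
    (2 * Real.pi)⁻¹
  rw [finrank_euclideanSpace_fin, inv_pow, inv_inv, abs_of_pos (by positivity), smul_eq_mul] at hsub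
  -- The Jacobian of `w ↦ w/(2π)` cancels the squared prefactor of `hat`.
  have hD : ((2 * Real.pi) ^ (-(d : ℝ) / 2)) ^ 2 * (2 * Real.pi) ^ d = 1 := by
    rw [← Real.rpow_natCast, ← Real.rpow_mul hpi2.le, ← Real.rpow_natCast, ← Real.rpow_add hpi2]
    simp
  have hres : ∫ w, ‖𝓕 g w‖ ^ 2 = ((2 * Real.pi) ^ (-(d : ℝ) / 2)) ^ 2 *
      ∫ w, ‖𝓕 g ((2 * Real.pi)⁻¹ • w)‖ ^ 2 := by
    rw [hsub, ← mul_assoc, hD, one_mul]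
  rw [hres, ← integral_const_mul]
  refine integral_congr_ae (.of_forall fun w => ?_)
  have hn : ‖w‖ ^ 2 = 4 * Real.pi ^ 2 * ‖(2 * Real.pi)⁻¹ • w‖ ^ 2 := by
    rw [norm_smul, mul_pow, norm_inv, Real.norm_of_nonneg hpi2.le]
    field_simp
    norm_num
  have hi : 2 * ⟪a, w⟫ = 4 * Real.pi * ⟪a, (2 * Real.pi)⁻¹ • w⟫ := by
    rw [inner_smul_right]
    field_simp
    ring
  simp only [hF, norm_mul, mul_pow, hp, sq_norm_fourier_gaussDensity_sub, hat_eq_fourier,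
    Complex.norm_real, Real.norm_eq_abs, sq_abs, hn, hi]
  ring

end Fourier

/-! ### The constants -/

/-- The integrand in the condition on the constants, for unit variance. -/
noncomputable def curvature {d : ℕ} (ψ : Eu d → ℝ) (a e w : Eu d) : ℝ :=
  Real.exp (-(1 * ‖w‖ ^ 2)) * ⟪e, w⟫ ^ 2 * Real.cos ⟪a, w⟫ * ‖hat ψ w‖ ^ 2

theorem continuous_curvature {d : ℕ} {ψ : Eu d → ℝ} (hint : Integrable ψ) {X : Type*}
    [TopologicalSpace X] {a e w : X → Eu d} (ha : Continuous a) (he : Continuous e)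
    (hw : Continuous w) : Continuous fun x => curvature ψ (a x) (e x) (w x) := by
  have := continuous_hat hint
  unfold curvature
  fun_prop

theorem integrable_exp_neg_mul_sq {d : ℕ} :
    Integrable fun w : Eu d => Real.exp (-‖w‖ ^ 2) * ‖w‖ ^ 2 := by
  have h : Integrable fun w : Eu d => Real.exp (-(1 / 2) * ‖w‖ ^ 2) := by
    by_contra h
    have h1 := GaussianFourier.integral_rexp_neg_mul_sq_norm (V := Eu d) (b := 1 / 2) (by norm_num)
    rw [integral_undef h] at h1
    exact (by positivity : (Real.pi / (1 / 2)) ^ (Module.finrank ℝ (Eu d) / 2 : ℝ) ≠ 0) h1.symm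
  refine (h.const_mul 2).mono' (by fun_prop) (.of_forall fun w => ?_)
  rw [Real.norm_of_nonneg (by positivity)]
  have h1 := Real.add_one_le_exp (1 / 2 * ‖w‖ ^ 2)
  have h2 : Real.exp (-‖w‖ ^ 2) * Real.exp (1 / 2 * ‖w‖ ^ 2) = Real.exp (-(1 / 2) * ‖w‖ ^ 2) := by
    rw [← Real.exp_add]
    congr 1
    ring
  rw [← h2]
  nlinarith [Real.exp_pos (-‖w‖ ^ 2)]

theorem exists_curvature_bound {d : ℕ} (ψ : Eu d → ℝ) : ∃ b : Eu d → ℝ, Integrable b ∧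
    ∀ a e w : Eu d, ‖e‖ = 1 → ‖curvature ψ a e w‖ ≤ b w := by
  obtain ⟨C, hC⟩ := exists_norm_hat_le ψ
  refine ⟨fun w => Real.exp (-‖w‖ ^ 2) * ‖w‖ ^ 2 * C ^ 2, integrable_exp_neg_mul_sq.mul_const _,
    fun a e w he => ?_⟩
  have h1 : |⟪e, w⟫| ≤ ‖w‖ := by simpa [he] using abs_real_inner_le_norm e w
  have h2 : |⟪e, w⟫ ^ 2 * Real.cos ⟪a, w⟫| ≤ ‖w‖ ^ 2 := by
    rw [abs_mul, abs_pow, ← mul_one (‖w‖ ^ 2)]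
    exact mul_le_mul (pow_le_pow_left₀ (abs_nonneg _) h1 2) (Real.abs_cos_le_one _) (abs_nonneg _)
      (by positivity)
  rw [curvature, one_mul, mul_assoc (Real.exp _), norm_mul, norm_mul,
    Real.norm_of_nonneg (Real.exp_pos _).le, Real.norm_eq_abs,
    Real.norm_of_nonneg (by positivity : 0 ≤ ‖hat ψ w‖ ^ 2)]
  exact mul_le_mul (mul_le_mul_of_nonneg_left h2 (Real.exp_pos _).le)
    (pow_le_pow_left₀ (norm_nonneg _) (hC w) 2) (by positivity) (by positivity)

theorem integral_curvature_zero_pos {d : ℕ} {ψ : Eu d → ℝ} (hint : Integrable ψ)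
    (hne : ∃ w, hat ψ w ≠ 0) {e : Eu d} (he : ‖e‖ = 1) : 0 < ∫ w, curvature ψ 0 e w := by
  obtain ⟨b, hb, hbound⟩ := exists_curvature_bound ψ
  have hc : Continuous (curvature ψ 0 e) :=
    continuous_curvature hint continuous_const continuous_const continuous_id
  have hi : Integrable (curvature ψ 0 e) :=
    hb.mono' hc.aestronglyMeasurable (.of_forall fun w => hbound 0 e w he)
  have h0 : 0 ≤ curvature ψ 0 e := fun w => by
    simp only [curvature, inner_zero_left, Real.cos_zero, Pi.zero_apply]
    positivity
  rw [integral_pos_iff_support_of_nonneg h0 hi]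
  refine hc.isOpen_support.measure_pos _ ?_
  suffices h : ∃ w, hat ψ w ≠ 0 ∧ ⟪e, w⟫ ≠ 0 by
    obtain ⟨w, h1, h2⟩ := h
    refine ⟨w, ?_⟩
    simp [curvature, h1, h2]
  obtain ⟨w, hw⟩ := hne
  by_cases hew : ⟪e, w⟫ = 0
  -- If `w ⟂ e`, a small shift of `w` along `e` keeps `ψ^` nonzero and makes the inner product
  -- nonzero.
  · have hcont : Continuous fun s : ℝ => hat ψ (w + s • e) :=
      (continuous_hat hint).comp (by fun_prop)
    have hev : ∀ᶠ s : ℝ in nhds 0, hat ψ (w + s • e) ≠ 0 :=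
      hcont.continuousAt.eventually_ne (by simpa using hw)
    obtain ⟨s, hs, hs0⟩ := ((hev.filter_mono nhdsWithin_le_nhds).and
      (self_mem_nhdsWithin (a := (0 : ℝ)) (s := {0}ᶜ))).exists
    refine ⟨_, hs, ?_⟩
    rw [inner_add_right, inner_smul_right, hew, real_inner_self_eq_norm_sq, he]
    simpa using hs0
  · exact ⟨w, hw, hew⟩

theorem exists_admissibleConstants {d : ℕ} (hd : 1 ≤ d) {ψ : Eu d → ℝ} (hint : Integrable ψ)
    (hne : ∃ w, hat ψ w ≠ 0) : ∃ c ε : ℝ, AdmissibleConstants ψ 1 c ε := by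
  obtain ⟨b, hb, hbound⟩ := exists_curvature_bound ψ
  let S := Metric.sphere (0 : Eu d) 1
  have hS : ∀ e : S, ‖(e : Eu d)‖ = 1 := fun e => mem_sphere_zero_iff_norm.mp e.2
  let F : Eu d × S → ℝ := fun x => ∫ w, curvature ψ x.1 x.2 w
  have hF : Continuous F := by
    refine continuous_of_dominated (bound := b) (fun x => ?_)
      (fun x => .of_forall fun w => hbound _ _ w (hS _)) hb (.of_forall fun w => ?_)
    · exact (continuous_curvature hint continuous_const continuous_const
        continuous_id).aestronglyMeasurable
    · exact continuous_curvature hint continuous_fst (continuous_subtype_val.comp continuous_snd)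
        continuous_const
  let e₁ : S := ⟨EuclideanSpace.single ⟨0, hd⟩ 1, by simp [S]⟩
  have hF0 : Continuous fun e : S => F (0, e) := hF.comp (by fun_prop)
  have : CompactSpace S := isCompact_iff_compactSpace.mp (isCompact_sphere _ _)
  obtain ⟨e₀, -, hmin⟩ := isCompact_univ.exists_isMinOn ⟨e₁, Set.mem_univ _⟩ hF0.continuousOn
  have hm : 0 < F (0, e₀) := integral_curvature_zero_pos hint hne (hS e₀)
  have hev : ∀ᶠ a in nhds (0 : Eu d), ∀ e ∈ (Set.univ : Set S), F (0, e₀) / 2 < F (a, e) := by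
    refine isCompact_univ.eventually_forall_of_forall_eventually fun e _ => ?_
    refine hF.continuousAt.eventually (lt_mem_nhds ?_)
    have := hmin (Set.mem_univ e)
    simp only [Set.mem_ofPred_eq] at this
    linarith
  obtain ⟨r, hr, hball⟩ := Metric.eventually_nhds_iff.mp hev
  -- Near `a = 0` the integral exceeds half its minimum; the factor 2 in the condition restores the
  -- full minimum as `c`. Halving `r` puts the closed ball inside the open one.
  refine ⟨F (0, e₀), (r / 2) ^ 2, hm, by positivity, fun a ha e he => ?_⟩
  have ha' : ‖a‖ ≤ r / 2 := (pow_le_pow_iff_left₀ (norm_nonneg _) (by positivity) two_ne_zero).mp ha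
  have h1 := hball (y := a) (by rw [dist_zero_right]; linarith)
    ⟨e, mem_sphere_zero_iff_norm.mpr he⟩ (Set.mem_univ _)
  have h2 : F (a, ⟨e, mem_sphere_zero_iff_norm.mpr he⟩) = ∫ w, curvature ψ a e w := rfl
  rw [h2] at h1
  change _ ≤ 2 * ∫ w, curvature ψ a e w
  linarith

/-- Taylor's formula for `s ↦ cos(su)` at 0 with second-order integral remainder. -/
theorem integral_sub_mul_sq_mul_cos (t u : ℝ) :
    ∫ s in (0 : ℝ)..t, (t - s) * (u ^ 2 * Real.cos (s * u)) = 1 - Real.cos (t * u) := by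
  have hd : ∀ s ∈ Set.uIcc 0 t, HasDerivAt
      (fun s => (t - s) * (u * Real.sin (s * u)) - Real.cos (s * u))
      ((t - s) * (u ^ 2 * Real.cos (s * u))) s := by
    intro s _
    have h1 : HasDerivAt (fun s : ℝ => s * u) u s := by simpa using (hasDerivAt_id s).mul_const u
    have h2 : HasDerivAt (fun s : ℝ => t - s) (-1) s := by
      simpa using (hasDerivAt_id s).const_sub t
    convert! (h2.mul (h1.sin.const_mul u)).sub h1.cos using 1
    ring
  rw [intervalIntegral.integral_eq_sub_of_hasDerivAt hd
    (Continuous.intervalIntegrable (by fun_prop) _ _)]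
  simp
  ring

/-- Along a line the second derivative bound integrates to a quadratic lower bound. -/
theorem AdmissibleConstants.sq_le_integral {d : ℕ} {ψ : Eu d → ℝ} (hint : Integrable ψ) {c ε : ℝ}
    (h : AdmissibleConstants ψ 1 c ε) {e : Eu d} (he : ‖e‖ = 1) {t : ℝ} (ht : 0 ≤ t)
    (htε : t ^ 2 ≤ ε) :
    c * t ^ 2 / 2 ≤
      2 * ∫ w : Eu d, Real.exp (-‖w‖ ^ 2) * (1 - Real.cos (t * ⟪e, w⟫)) * ‖hat ψ w‖ ^ 2 := by
  obtain ⟨b, hb, hbound⟩ := exists_curvature_bound ψ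
  have hcont : Continuous fun z : ℝ × Eu d => (t - z.1) * curvature ψ (z.1 • e) e z.2 :=
    (continuous_const.sub continuous_fst).mul (continuous_curvature hint
      (continuous_fst.smul continuous_const) continuous_const continuous_snd)
  have hI : Integrable (Function.uncurry fun (s : ℝ) (w : Eu d) =>
      (t - s) * curvature ψ (s • e) e w) ((volume.restrict (Set.uIoc 0 t)).prod volume) := by
    have hts : Integrable (fun s : ℝ => |t - s|) (volume.restrict (Set.uIoc 0 t)) :=
      ((by fun_prop : Continuous fun s : ℝ => |t - s|).intervalIntegrable 0 t).def'
    refine (hts.mul_prod hb).mono' hcont.aestronglyMeasurable (.of_forall fun z => ?_)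
    simp only [Function.uncurry]
    rw [norm_mul, Real.norm_eq_abs]
    exact mul_le_mul_of_nonneg_left (hbound _ _ _ he) (abs_nonneg _)
  have hswap := intervalIntegral_integral_swap hI
  have hJ : IntervalIntegrable (fun s => ∫ w, (t - s) * curvature ψ (s • e) e w) volume 0 t :=
    intervalIntegrable_iff.mpr hI.integral_prod_left
  have hinner : ∀ w : Eu d, ∫ s in (0 : ℝ)..t, (t - s) * curvature ψ (s • e) e w =
      Real.exp (-‖w‖ ^ 2) * (1 - Real.cos (t * ⟪e, w⟫)) * ‖hat ψ w‖ ^ 2 := by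
    intro w
    rw [← integral_sub_mul_sq_mul_cos, ← intervalIntegral.integral_const_mul,
      ← intervalIntegral.integral_mul_const]
    refine intervalIntegral.integral_congr fun s _ => ?_
    simp only [curvature, one_mul, real_inner_smul_left]
    ring
  simp only [hinner] at hswap
  rw [← hswap]
  have hlow : ∫ s in (0 : ℝ)..t, (t - s) * (c / 2) ≤
      ∫ s in (0 : ℝ)..t, ∫ w, (t - s) * curvature ψ (s • e) e w := by
    refine intervalIntegral.integral_mono_on ht
      (Continuous.intervalIntegrable (by fun_prop) _ _) hJ fun s hs => ?_
    rw [integral_const_mul]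
    refine mul_le_mul_of_nonneg_left ?_ (sub_nonneg.mpr hs.2)
    have hn : ‖s • e‖ ^ 2 ≤ ε := by
      rw [norm_smul, he, mul_one, Real.norm_eq_abs, sq_abs]
      exact (pow_le_pow_left₀ hs.1 hs.2 2).trans htε
    have := h.2.2 (s • e) hn e he
    change c ≤ 2 * ∫ w, curvature ψ (s • e) e w at this
    linarith
  have hval : ∫ s in (0 : ℝ)..t, (t - s) * (c / 2) = c * t ^ 2 / 4 := by
    rw [intervalIntegral.integral_mul_const, intervalIntegral.integral_sub
      (Continuous.intervalIntegrable (by fun_prop) _ _)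
      (Continuous.intervalIntegrable (by fun_prop) _ _)]
    simp
    ring
  linarith

/-! ### The minimax bound -/

/-- Holds without integrability of `g²`, since the norm of the integral never exceeds the lower
integral of the norm. -/
theorem ofReal_le_eLpNorm_two {X : Type*} [MeasurableSpace X] {μ : Measure X} {g : X → ℝ} {s : ℝ}
    (hs : 0 ≤ s) (h : s ^ 2 ≤ ∫ x, g x ^ 2 ∂μ) : ENNReal.ofReal s ≤ eLpNorm g 2 μ := by
  have h1 : ENNReal.ofReal s ^ (2 : ℝ) ≤ eLpNorm g 2 μ ^ (2 : ℝ) := by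
    have h2 := eLpNorm_nnreal_pow_eq_lintegral (μ := μ) (f := g) (p := 2) two_ne_zero
    have h3 : ENNReal.ofReal (s ^ 2) ≤ ‖∫ x, g x ^ 2 ∂μ‖ₑ := by
      rw [Real.enorm_eq_ofReal_abs]
      exact ENNReal.ofReal_le_ofReal (h.trans (le_abs_self _))
    have h4 : ∫⁻ x, ‖g x ^ 2‖ₑ ∂μ = ∫⁻ x, ‖g x‖ₑ ^ (2 : ℝ) ∂μ := by
      simp [enorm_pow]
    rw [ENNReal.rpow_ofNat, ← ENNReal.ofReal_pow hs]
    refine (h3.trans (enorm_integral_le_lintegral_enorm _)).trans (h4.le.trans ?_)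
    simpa using h2.ge
  exact (ENNReal.rpow_le_rpow_iff two_pos).mp h1

theorem one_fourth_le_minimaxProb {d : ℕ} {ψ : Eu d → ℝ} (hc : Continuous ψ)
    (h : IsPositiveDefinite ψ) {n : ℕ} {s : ℝ} (hs : 0 ≤ s) {a : Eu d}
    (ha : n * ‖a‖ ^ 2 = 1 / 4)
    (hsep : (2 * s) ^ 2 ≤ ∫ y, (kme ψ h (gauss a) y - kme ψ h (gauss (-a)) y) ^ 2) :
    1 / 4 ≤ minimaxProb ψ h (smoothDensity d) n s := by
  refine le_iInf fun θ => ?_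
  let A : Eu d → Set (Fin n → Eu d) := fun b =>
    {x | ENNReal.ofReal s ≤ eLpNorm (fun y => θ.1 x y - kme ψ h (gauss b) y) 2 volume}
  -- An estimate closer than `s` to both embeddings would contradict their separation `2s`, by the
  -- triangle inequality.
  have hcover : (A a)ᶜ ⊆ A (-a) := by
    intro x hx
    by_contra hx'
    simp only [A, Set.mem_compl_iff, Set.mem_ofPred_eq, not_le] at hx hx'
    have hk : ∀ b, AEStronglyMeasurable (fun y => θ.1 x y - kme ψ h (gauss b) y) volume :=
      fun b => (Lp.aestronglyMeasurable _).sub (continuous_coe_Hk hc h _).aestronglyMeasurable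
    have h1 := eLpNorm_sub_le (p := 2) (hk (-a)) (hk a) (by norm_num)
    have h2 : ((fun y => θ.1 x y - kme ψ h (gauss (-a)) y) -
        fun y => θ.1 x y - kme ψ h (gauss a) y) =
        fun y => kme ψ h (gauss a) y - kme ψ h (gauss (-a)) y := by
      funext y
      simp
    rw [h2] at h1
    have h3 := (ofReal_le_eLpNorm_two (by positivity) hsep).trans h1
    have h4 := h3.trans_lt (ENNReal.add_lt_add hx' hx)
    rw [← ENNReal.ofReal_add hs hs, ← two_mul] at h4
    exact lt_irrefl _ h4
  have h1 := half_le_pi_gauss_add a ha hcover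
  have hle : ∀ b, Measure.pi (fun _ : Fin n => (gauss b : Measure (Eu d))) (A b) ≤
      ⨆ P ∈ smoothDensity d, Measure.pi (fun _ : Fin n => (P : Measure (Eu d)))
        {x | ENNReal.ofReal s ≤ eLpNorm (fun y => θ.1 x y - kme ψ h P y) 2 volume} := fun b =>
    le_iSup₂_of_le (gauss b) (gauss_mem_smoothDensity b) le_rfl
  by_contra! hlt
  have h2 := h1.trans_lt (ENNReal.add_lt_add ((hle a).trans_lt hlt) ((hle (-a)).trans_lt hlt))
  refine absurd h2 (not_lt.mpr (le_of_eq ?_))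
  rw [ENNReal.div_add_div_same, one_add_one_eq_two, ENNReal.div_eq_div_iff] <;> norm_num

end KernelMean

theorem theorem12 (d : ℕ) (hd : 1 ≤ d) (ψ : KernelMean.Eu d →ᵇ ℝ)
    (hint : Integrable ψ volume) (hpd : KernelMean.IsPositiveDefinite ψ)
    (hchar : KernelMean.IsCharacteristic ψ hpd) :
    (∃ c ε : ℝ, KernelMean.AdmissibleConstants ψ 1 c ε) ∧
    ∀ c ε : ℝ, KernelMean.AdmissibleConstants ψ 1 c ε →
      ∀ n : ℕ, 1 / ε ≤ (n : ℝ) →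
        (1 / 4 : ℝ≥0∞) ≤ KernelMean.minimaxProb ψ hpd (KernelMean.smoothDensity d) n
          (1 / 2 * √(c / (2 * n))) := by
  refine ⟨KernelMean.exists_admissibleConstants hd hint (KernelMean.exists_hat_ne_zero
    ψ.continuous hint (KernelMean.exists_ne_zero_of_isCharacteristic hd hchar)),
    fun c ε h n hn => ?_⟩
  have hc := h.1
  have hn0 : (0 : ℝ) < n := (one_div_pos.mpr h.2.1).trans_le hn
  have ht : (√(1 / n : ℝ)) ^ 2 = 1 / n := Real.sq_sqrt (by positivity)
  set t : ℝ := √(1 / n : ℝ)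
  have ht0 : 0 ≤ t := Real.sqrt_nonneg _
  let e : KernelMean.Eu d := EuclideanSpace.single ⟨0, hd⟩ 1
  have he : ‖e‖ = 1 := by simp [e]
  -- With `t² = 1/n` this choice gives `n‖a‖² = 1/4`, and the separation `c t²/2 = c/(2n)` is
  -- exactly the square of twice the threshold.
  refine KernelMean.one_fourth_le_minimaxProb (a := (t / 2) • e) ψ.continuous hpd (by positivity)
    ?_ ?_
  · rw [norm_smul, he, mul_one, Real.norm_eq_abs, sq_abs, div_pow, ht]
    field_simp
    norm_num
  · rw [KernelMean.integral_sq_kme_gauss_sub ψ.continuous hint]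
    have hε : t ^ 2 ≤ ε := by
      rw [ht]
      exact (one_div_le h.2.1 hn0).mp hn
    have key := h.sq_le_integral hint he ht0 hε
    have hi : ∀ w, 2 * ⟪(t / 2) • e, w⟫ = t * ⟪e, w⟫ := fun w => by
      rw [real_inner_smul_left]
      ring
    simp only [hi]
    refine le_trans (le_of_eq ?_) key
    rw [← mul_assoc, mul_one_div_cancel two_ne_zero, one_mul, Real.sq_sqrt (by positivity), ht]
    field_simp
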